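/- Let $0 < m < n$ be integers and let $K \subset \mathbb{R}^{n}$ be an arbitrary set (no measurability is assumed). Let $G(n,m)$ be the Grassmannian of $m$-dimensional linear subspaces of $\mathbb{R}^{n}$, let $\gamma_{n,m}$ be the $O(n)$-invariant Borel probability measure on $G(n,m)$ (the distribution of $gV_{0}$, where $V_{0} \in G(n,m)$ is fixed and $g$ is distributed according to the normalised Haar measure on $O(n)$), and let $\pi_{V} \colon \mathbb{R}^{n} \to V$ be the orthogonal projection onto $V \in G(n,m)$. Then $$\dim_{\mathrm{p}} \pi_{V}(K) \geq \min\{\dim_{\mathrm{H}} K, m\} \qquad \text{for } \gamma_{n,m}\text{-almost every } V \in G(n,m).$$ Here $\dim_{\mathrm{H}}$ is Hausdorff dimension and $\dim_{\mathrm{p}}$ is packing dimension: for $A \subset \mathbb{R}^{n}$, $$\dim_{\mathrm{p}} A = \inf\Big\{ \sup_{i \in \mathbb{N}} \overline{\dim}_{\mathrm{B}}\, F_{i} : F_{i} \text{ is bounded and } A \subset \bigcup_{i \in \mathbb{N}} F_{i} \Big\}, \qquad \overline{\dim}_{\mathrm{B}}\, F = \limsup_{\delta \to 0+} \frac{\log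 N(F,\delta)}{-\log \delta},$$ where $N(F,\delta)$ is the least number of open balls of radius $\delta$ needed to cover the bounded set $F$, and $\overline{\dim}_{\mathrm{B}}\, \emptyset = 0$. -/

import Mathlib

open MeasureTheory Filter Topology Set

noncomputable section

namespace ProjDim

/-! ### Box counting and packing dimension -/

/-- `coverNum F δ` is the least number of open balls of radius `δ` (centred anywhere in `ℝⁿ`) needed
to cover `F`. It is a genuine minimum for bounded `F` and `δ > 0`, the only case used below. -/
def coverNum {n : ℕ} (F : Set (EuclideanSpace ℝ (Fin n))) (δ : ℝ) : ℕ :=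
  sInf {k : ℕ | ∃ C : Finset (EuclideanSpace ℝ (Fin n)),
    C.card = k ∧ F ⊆ ⋃ x ∈ C, Metric.ball x δ}

/-- In `ℝⁿ` a bounded set has a cover by finitely many balls of radius `δ > 0`, so that the infimum
defining `coverNum` is attained. -/
theorem exists_cover_card_eq_coverNum {n : ℕ} {F : Set (EuclideanSpace ℝ (Fin n))}
    (hF : Bornology.IsBounded F) {δ : ℝ} (hδ : 0 < δ) :
    ∃ C : Finset (EuclideanSpace ℝ (Fin n)),
      C.card = coverNum F δ ∧ F ⊆ ⋃ x ∈ C, Metric.ball x δ := by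
  have hne : {k : ℕ | ∃ C : Finset (EuclideanSpace ℝ (Fin n)),
      C.card = k ∧ F ⊆ ⋃ x ∈ C, Metric.ball x δ}.Nonempty := by
    obtain ⟨t, ht, hcov⟩ := Metric.totallyBounded_iff.1
      (hF.isCompact_closure.totallyBounded.subset subset_closure) δ hδ
    exact ⟨_, ht.toFinset, rfl, by simpa using hcov⟩
  exact Nat.sInf_mem hne

/-- The upper box dimension `limsup_{δ → 0+} log N(F, δ) / (-log δ)` of a bounded set `F ⊆ ℝⁿ`.
The quotient is nonnegative for `0 < δ < 1`, so that `ENNReal.ofReal` only changes its type; the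
empty set gets the value `0`. -/
def upperBoxDim {n : ℕ} (F : Set (EuclideanSpace ℝ (Fin n))) : ENNReal :=
  limsup (fun δ : ℝ => ENNReal.ofReal (Real.log (coverNum F δ) / (-Real.log δ))) (𝓝[>] (0 : ℝ))

/-- The packing dimension of an arbitrary set `K ⊆ ℝⁿ`: the infimum of `sup_i upperBoxDim (F i)` over
all countable covers of `K` by bounded sets `F i`. -/
def packingDim {n : ℕ} (K : Set (EuclideanSpace ℝ (Fin n))) : ENNReal :=
  ⨅ (F : ℕ → Set (EuclideanSpace ℝ (Fin n))) (_ : ∀ i, Bornology.IsBounded (F i))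
    (_ : K ⊆ ⋃ i, F i), ⨆ i, upperBoxDim (F i)

/-! ### The Grassmannian and its invariant measure -/

/-- The Grassmannian `G(n, m)` of `m`-dimensional linear subspaces of `ℝⁿ`. -/
def Grass (n m : ℕ) : Type :=
  {V : Submodule ℝ (EuclideanSpace ℝ (Fin n)) // Module.finrank ℝ V = m}

/-- The orthogonal projection `π_V : ℝⁿ → V`, with `V` regarded as a subset of `ℝⁿ`. -/
def Grass.proj {n m : ℕ} (V : Grass n m) :
    EuclideanSpace ℝ (Fin n) →L[ℝ] EuclideanSpace ℝ (Fin n) :=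
  V.1.starProjection

theorem Grass.proj_injective (n m : ℕ) :
    Function.Injective (Grass.proj : Grass n m → _) :=
  fun _ _ h => Subtype.ext (Submodule.starProjection_inj.1 h)

/-- The standard metric `d(V, W) = ‖π_V - π_W‖` (operator norm) on `G(n, m)`. -/
instance (n m : ℕ) : MetricSpace (Grass n m) :=
  MetricSpace.induced Grass.proj (Grass.proj_injective n m) inferInstance

/-- The Borel `σ`-algebra of `G(n, m)`. -/
instance (n m : ℕ) : MeasurableSpace (Grass n m) := borel _

instance (n m : ℕ) : BorelSpace (Grass n m) := ⟨rfl⟩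

/-- The orthogonal group `O(n)`: the linear maps `g : ℝⁿ → ℝⁿ` with `gᵀ g = g gᵀ = 1`, with the
topology of the operator norm. -/
abbrev OrthGroup (n : ℕ) : Type :=
  unitary (EuclideanSpace ℝ (Fin n) →L[ℝ] EuclideanSpace ℝ (Fin n))

theorem continuousStar_aux (H : Type*) [NormedAddCommGroup H] [InnerProductSpace ℝ H]
    [CompleteSpace H] : ContinuousStar (H →L[ℝ] H) := inferInstance

instance (n : ℕ) : ContinuousStar (EuclideanSpace ℝ (Fin n) →L[ℝ] EuclideanSpace ℝ (Fin n)) :=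
  continuousStar_aux _

instance (n : ℕ) : CompactSpace (OrthGroup n) := by
  have : ProperSpace (EuclideanSpace ℝ (Fin n) →L[ℝ] EuclideanSpace ℝ (Fin n)) :=
    FiniteDimensional.proper ℝ _
  refine isCompact_iff_compactSpace.1 (Metric.isCompact_of_isClosed_isBounded isClosed_unitary ?_)
  refine (Metric.isBounded_closedBall (x := 0) (r := 1)).subset fun g hg => ?_
  rw [mem_closedBall_zero_iff]
  refine ContinuousLinearMap.opNorm_le_bound _ zero_le_one fun x => ?_
  have h : ‖g x‖ = ‖x‖ := (Unitary.linearIsometryEquiv ⟨g, hg⟩).norm_map x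
  rw [h, one_mul]

/-- The Haar measure of the compact group `O(n)`, normalised to have total mass one. -/
def orthHaar (n : ℕ) : Measure (OrthGroup n) := Measure.haarMeasure ⊤

instance (n : ℕ) : IsProbabilityMeasure (orthHaar n) := ⟨by
  have h := Measure.haarMeasure_self (K₀ := (⊤ : TopologicalSpace.PositiveCompacts (OrthGroup n)))
  rwa [TopologicalSpace.PositiveCompacts.coe_top] at h⟩

/-- The image plane `gV` of `V ∈ G(n, m)` under `g ∈ O(n)`. -/
def Grass.rotate {n m : ℕ} (g : OrthGroup n) (V : Grass n m) : Grass n m :=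
  ⟨V.1.map ((Unitary.linearIsometryEquiv g).toLinearEquiv :
      EuclideanSpace ℝ (Fin n) →ₗ[ℝ] EuclideanSpace ℝ (Fin n)),
    (LinearEquiv.finrank_map_eq _ _).trans V.2⟩

/-- `gV` consists of the vectors `g x`, `x ∈ V`. -/
theorem Grass.coe_rotate {n m : ℕ} (g : OrthGroup n) (V : Grass n m) :
    ((V.rotate g).1 : Set (EuclideanSpace ℝ (Fin n))) =
      (g : EuclideanSpace ℝ (Fin n) →L[ℝ] EuclideanSpace ℝ (Fin n)) '' V.1 := rfl

/-- `π_{gV} = g π_V g⁻¹`. -/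
theorem Grass.proj_rotate {n m : ℕ} (g : OrthGroup n) (V : Grass n m) :
    (V.rotate g).proj = g.1 * V.proj * (g⁻¹).1 := by
  ext1 x
  exact Submodule.starProjection_map_apply (Unitary.linearIsometryEquiv g) V.1 x

theorem Grass.continuous_rotate {n m : ℕ} (V : Grass n m) :
    Continuous fun g : OrthGroup n => V.rotate g := by
  refine continuous_induced_rng.2 ?_
  have h : (Grass.proj ∘ fun g : OrthGroup n => V.rotate g) = fun g => g.1 * V.proj * (g⁻¹).1 :=
    funext fun g => V.proj_rotate g
  rw [h]
  exact (continuous_subtype_val.mul continuous_const).mul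
    (continuous_subtype_val.comp continuous_inv)

/-- The coordinate plane spanned by the first `m` standard basis vectors of `ℝⁿ`. -/
def Grass.coordPlane {n m : ℕ} (h : m ≤ n) : Grass n m :=
  ⟨Submodule.span ℝ (range fun i : Fin m => EuclideanSpace.single (Fin.castLE h i) (1 : ℝ)), by
    have hli : LinearIndependent ℝ
        fun i : Fin m => EuclideanSpace.single (Fin.castLE h i) (1 : ℝ) :=
      ((EuclideanSpace.orthonormal_single (𝕜 := ℝ) (ι := Fin n)).comp _
        (Fin.castLE_injective h)).linearIndependent
    simpa using finrank_span_eq_card hli⟩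

/-- The `O(n)`-invariant Borel probability measure `γ_{n,m}` on `G(n, m)`: the distribution of `g V₀`,
where `g ∈ O(n)` is random with respect to the normalised Haar measure and `V₀` is a fixed
`m`-plane. -/
def grassMeasure {n m : ℕ} (h : m ≤ n) : Measure (Grass n m) :=
  (orthHaar n).map fun g => (Grass.coordPlane h).rotate g

instance {n m : ℕ} (h : m ≤ n) : IsProbabilityMeasure (grassMeasure h) :=
  Measure.isProbabilityMeasure_map (Grass.continuous_rotate _).measurable.aemeasurable

end ProjDim

end

/-!
The set `K` need not be measurable, and the pieces of `K` in a countable cover that witnesses a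
small packing dimension of `π_V K` depend on `V` without any regularity, so that it does not help
to project a fixed measure on `K`. Instead one fixes a sequence of efficient covers of `K` that does not depend on
`V`, and bounds the measure of the planes for which *some* large part of the cover has a small
projection.

Let `t < τ < min (dimH K) m`, and let `s < dimH K < σ` be close together. As `μH[σ] K = 0`, for each
`L` there are finite sets `P k`, `k > L`, such that `K` is covered by the balls of radius `≈ 2 ^
(-k)` around the points of all the `P k`, and each `P k` has at most `2 ^ (k σ)` points and is at
most `σ`-dimensional at all scales between `1` and `2 ^ (-k)` (`exists_katzTao_cover`, after Katz
and Tao). By the transversality of projections, `γ {V : ‖π_V x‖ ≤ r ‖x‖} ≲ r ^ m`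
(`exists_grassMeasure_cone_le`), the average over `V` of the number of pairs in `P k` with
projections within `≈ 2 ^ (-k)` of each other is at most `≈ 2 ^ (k (2 σ - τ))`, up to a factor
linear in `k` (`exists_grassMeasure_closePairs_le`). On the other hand, if some part of `P k` with
about `2 ^ (k s)` points has a projection covered by `2 ^ (k t)` balls of radius `≈ 2 ^ (-k)`, then
there are at least about `2 ^ (k (2 s - t))` such pairs, by Cauchy–Schwarz. Hence the planes for
which this happens at some scale `k > L` have a measure that tends to zero as `L → ∞`, and almost
every `V` avoids them for infinitely many `L`.

For such a `V`, a subset `A ⊆ K` whose projection needs at most `2 ^ (k t)` balls of radius `2 ^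
(-k)` for all large `k` is covered, for infinitely many `L`, by fewer than about `2 ^ (k s)` balls
of each radius `≈ 2 ^ (-k)`, `k > L`, so that `A` is an `s`-dimensional null set
(`ae_hausdorffMeasure_eq_zero`). If `π_V K` had packing dimension less than `t`, then `K` would be a
countable union of such sets `A`, which contradicts `s < dimH K`. -/

namespace ProjDim

/-! ### Transversality of projections -/

theorem OrthGroup.norm_apply {n : ℕ} (g : OrthGroup n) (x : EuclideanSpace ℝ (Fin n)) :
    ‖g.1 x‖ = ‖x‖ :=
  (Unitary.linearIsometryEquiv g).norm_map x

/-- The orthogonal group acts transitively on spheres, by reflections. -/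
theorem OrthGroup.exists_apply_eq {n : ℕ} {u v : EuclideanSpace ℝ (Fin n)} (h : ‖u‖ = ‖v‖) :
    ∃ g : OrthGroup n, g.1 u = v := by
  refine ⟨Unitary.linearIsometryEquiv.symm ((ℝ ∙ (u - v))ᗮ.reflection), ?_⟩
  exact Submodule.reflection_sub h

theorem Grass.norm_proj_rotate {n m : ℕ} (V : Grass n m) (g : OrthGroup n)
    (x : EuclideanSpace ℝ (Fin n)) : ‖(V.rotate g).proj x‖ = ‖V.proj ((g⁻¹).1 x)‖ := by
  rw [Grass.proj_rotate]
  exact OrthGroup.norm_apply g _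

theorem Grass.continuous_proj (n m : ℕ) : Continuous (Grass.proj : Grass n m → _) :=
  continuous_induced_dom

instance (n : ℕ) : (orthHaar n).IsMulLeftInvariant := by
  unfold orthHaar
  infer_instance

/-- The probability that `x` lies in the cone `‖π_{gV} x‖ ≤ r ‖x‖` around the orthogonal complement
of the random plane `gV` does not depend on `x ≠ 0`. -/
theorem orthHaar_cone_eq {n m : ℕ} (V : Grass n m) (r : ℝ) {u v : EuclideanSpace ℝ (Fin n)}
    (hu : u ≠ 0) (hv : v ≠ 0) :
    orthHaar n {g | ‖V.proj ((g⁻¹).1 u)‖ ≤ r * ‖u‖} =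
      orthHaar n {g | ‖V.proj ((g⁻¹).1 v)‖ ≤ r * ‖v‖} := by
  have hu' : 0 < ‖u‖ := norm_pos_iff.2 hu
  have hv' : 0 < ‖v‖ := norm_pos_iff.2 hv
  obtain ⟨h, hh⟩ := OrthGroup.exists_apply_eq (n := n) (u := u) (v := (‖u‖ / ‖v‖) • v)
    (by rw [norm_smul, Real.norm_of_nonneg (by positivity)]; field_simp)
  have key : {g : OrthGroup n | ‖V.proj ((g⁻¹).1 u)‖ ≤ r * ‖u‖} =
      (fun g => h * g) ⁻¹' {g | ‖V.proj ((g⁻¹).1 v)‖ ≤ r * ‖v‖} := by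
    ext g
    have h1 : ((h * g)⁻¹).1 ((‖u‖ / ‖v‖) • v) = (g⁻¹).1 u := by
      rw [← hh, mul_inv_rev]
      change (g⁻¹).1 ((h⁻¹ * h).1 u) = _
      rw [inv_mul_cancel]
      rfl
    rw [map_smul] at h1
    simp only [mem_ofPred_eq, mem_preimage]
    rw [← h1, map_smul, norm_smul, Real.norm_of_nonneg (by positivity : 0 ≤ ‖u‖ / ‖v‖),
      div_mul_eq_mul_div, div_le_iff₀ hv',
      show r * ‖u‖ * ‖v‖ = ‖u‖ * (r * ‖v‖) by ring, mul_le_mul_iff_right₀ hu']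
  rw [key, measure_preimage_mul]

theorem isClosed_cone {n m : ℕ} (V : Grass n m) (r : ℝ) :
    IsClosed {p : EuclideanSpace ℝ (Fin n) × OrthGroup n |
      ‖V.proj ((p.2⁻¹).1 p.1)‖ ≤ r * ‖p.1‖} := by
  have h1 : Continuous fun p : EuclideanSpace ℝ (Fin n) × OrthGroup n => (p.2⁻¹).1 p.1 :=
    (continuous_subtype_val.comp (continuous_inv.comp continuous_snd)).clm_apply continuous_fst
  exact isClosed_le (V.proj.continuous.comp h1).norm (continuous_const.mul continuous_fst.norm)

/-- Averaging the rotation-invariant probability of a cone over the unit ball turns it into a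
Lebesgue measure. -/
theorem orthHaar_cone_mul_volume_ball {n m : ℕ} (V : Grass n m) (r : ℝ)
    {x : EuclideanSpace ℝ (Fin n)} (hx : x ≠ 0) :
    orthHaar n {g | ‖V.proj ((g⁻¹).1 x)‖ ≤ r * ‖x‖} *
        volume (Metric.ball (0 : EuclideanSpace ℝ (Fin n)) 1) =
      volume ({y | ‖V.proj y‖ ≤ r * ‖y‖} ∩ Metric.ball (0 : EuclideanSpace ℝ (Fin n)) 1) := by
  have : Nontrivial (EuclideanSpace ℝ (Fin n)) := ⟨x, 0, hx⟩
  set B := Metric.ball (0 : EuclideanSpace ℝ (Fin n)) 1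
  let S := {p : EuclideanSpace ℝ (Fin n) × OrthGroup n | ‖V.proj ((p.2⁻¹).1 p.1)‖ ≤ r * ‖p.1‖}
  have hS : MeasurableSet S := (isClosed_cone V r).measurableSet
  have hswap := lintegral_lintegral_swap (μ := volume.restrict B) (ν := orthHaar n)
    (f := fun u g => S.indicator 1 (u, g))
    ((measurable_one.indicator hS).aemeasurable)
  have hcone : MeasurableSet {y : EuclideanSpace ℝ (Fin n) | ‖V.proj y‖ ≤ r * ‖y‖} :=
    (isClosed_le V.proj.continuous.norm (continuous_const.mul continuous_norm)).measurableSet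
  -- the integral over the group first
  have hl : ∀ u : EuclideanSpace ℝ (Fin n), u ≠ 0 →
      ∫⁻ g, S.indicator 1 (u, g) ∂(orthHaar n) =
        orthHaar n {g | ‖V.proj ((g⁻¹).1 x)‖ ≤ r * ‖x‖} := by
    intro u hu
    rw [orthHaar_cone_eq V r hx hu, ← lintegral_indicator_one]
    · rfl
    · exact measurable_prodMk_left hS
  -- the integral over the ball first
  have hr : ∀ g : OrthGroup n, ∫⁻ u, S.indicator 1 (u, g) ∂(volume.restrict B) =
      volume ({y | ‖V.proj y‖ ≤ r * ‖y‖} ∩ B) := by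
    intro g
    have hm : MeasurableSet {u : EuclideanSpace ℝ (Fin n) | (u, g) ∈ S} :=
      measurable_prodMk_right hS
    have h1 : ∫⁻ u, S.indicator 1 (u, g) ∂(volume.restrict B) =
        (volume.restrict B) {u : EuclideanSpace ℝ (Fin n) | (u, g) ∈ S} := by
      rw [← lintegral_indicator_one hm]
      rfl
    rw [h1, Measure.restrict_apply hm,
      ← (Unitary.linearIsometryEquiv g⁻¹).measurePreserving.measure_preimage
        (hcone.inter Metric.isOpen_ball.measurableSet).nullMeasurableSet]
    congr 1
    ext u
    have : ‖(g⁻¹).1 u‖ = ‖u‖ := OrthGroup.norm_apply _ _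
    change _ ∧ _ ↔ ‖V.proj ((g⁻¹).1 u)‖ ≤ r * ‖(g⁻¹).1 u‖ ∧ (g⁻¹).1 u ∈ B
    rw [this]
    simp only [B, mem_ball_zero_iff, this]
    rfl
  simp only [hr, lintegral_const, measure_univ, mul_one] at hswap
  rw [← hswap]
  have hae : ∀ᵐ u ∂(volume.restrict B), u ≠ 0 := by
    refine ae_restrict_of_ae ?_
    simp [ae_iff]
  rw [lintegral_congr_ae (hae.mono fun u hu => hl u hu)]
  simp

theorem abs_apply_le_norm_coordPlane_proj {n m : ℕ} (h : m ≤ n) (y : EuclideanSpace ℝ (Fin n))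
    (i : Fin m) : |y (Fin.castLE h i)| ≤ ‖(Grass.coordPlane h).proj y‖ := by
  set e : EuclideanSpace ℝ (Fin n) := EuclideanSpace.single (Fin.castLE h i) (1 : ℝ)
  have he : e ∈ (Grass.coordPlane h).1 := Submodule.subset_span ⟨i, rfl⟩
  have h1 : inner ℝ e y = y (Fin.castLE h i) := by simp [e, EuclideanSpace.inner_single_left]
  have h2 : inner ℝ e ((Grass.coordPlane h).proj y) = inner ℝ e y := by
    unfold Grass.proj
    rw [← Submodule.inner_starProjection_left_eq_right,
      Submodule.starProjection_eq_self_iff.2 he]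
  rw [← h1, ← h2]
  refine (abs_real_inner_le_norm _ _).trans ?_
  simp [e]

theorem volume_coordPlane_slab_le {n m : ℕ} (h : m ≤ n) {r : ℝ} (hr : 0 ≤ r) :
    volume ({y | ‖(Grass.coordPlane h).proj y‖ ≤ r * ‖y‖} ∩
      Metric.ball (0 : EuclideanSpace ℝ (Fin n)) 1) ≤ ENNReal.ofReal (2 ^ n * r ^ m) := by
  let a : Fin n → ℝ := fun i => if (i : ℕ) < m then r else 1
  have ha : ∀ i, 0 ≤ a i := fun i => by simp only [a]; split_ifs <;> positivity
  have hsub : ({y | ‖(Grass.coordPlane h).proj y‖ ≤ r * ‖y‖} ∩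
      Metric.ball (0 : EuclideanSpace ℝ (Fin n)) 1) ⊆
      WithLp.ofLp ⁻¹' (Set.pi univ fun i => Icc (-a i) (a i)) := by
    rintro y ⟨hy, hy1⟩ i -
    change y i ∈ Icc (-a i) (a i)
    rw [mem_ball_zero_iff] at hy1
    rw [mem_Icc, ← abs_le]
    by_cases hi : (i : ℕ) < m
    · simp only [a, if_pos hi]
      refine (abs_apply_le_norm_coordPlane_proj h y ⟨i, hi⟩).trans (hy.trans ?_)
      exact mul_le_of_le_one_right hr hy1.le
    · simp only [a, if_neg hi]
      exact (PiLp.norm_apply_le y i).trans hy1.le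
  refine (measure_mono hsub).trans ?_
  rw [(PiLp.volume_preserving_ofLp (Fin n)).measure_preimage
    (MeasurableSet.univ_pi fun i => measurableSet_Icc).nullMeasurableSet, volume_pi_pi]
  simp only [Real.volume_Icc]
  rw [← ENNReal.ofReal_prod_of_nonneg fun i _ => by linarith [ha i]]
  refine ENNReal.ofReal_le_ofReal (le_of_eq ?_)
  have : ∀ i, a i - -a i = 2 * a i := fun i => by ring
  simp only [this, Finset.prod_mul_distrib, Finset.prod_const, Finset.card_univ, Fintype.card_fin]
  congr 1
  simp only [a, Finset.prod_ite, Finset.prod_const, one_pow, mul_one]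
  congr 1
  rw [Fin.card_filter_val_lt, min_eq_right h]

/-- A random `m`-plane is nearly orthogonal to a given vector `x` with small probability:
`γ {V : ‖π_V x‖ ≤ r ‖x‖} ≲ r ^ m`. -/
theorem exists_grassMeasure_cone_le {n m : ℕ} (h : m ≤ n) :
    ∃ C : ℝ, 1 ≤ C ∧ ∀ (x : EuclideanSpace ℝ (Fin n)), x ≠ 0 → ∀ r : ℝ, 0 ≤ r →
      grassMeasure h {V | ‖V.proj x‖ ≤ r * ‖x‖} ≤ ENNReal.ofReal (C * r ^ m) := by
  set v := volume (Metric.ball (0 : EuclideanSpace ℝ (Fin n)) 1)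
  have hv0 : v ≠ 0 := (Metric.measure_ball_pos _ _ one_pos).ne'
  have hvt : v ≠ ⊤ := measure_ball_lt_top.ne
  have hvp : 0 < v.toReal := ENNReal.toReal_pos hv0 hvt
  refine ⟨max 1 (2 ^ n / v.toReal), le_max_left _ _, fun x hx r hr => ?_⟩
  have hmeas : MeasurableSet {V : Grass n m | ‖V.proj x‖ ≤ r * ‖x‖} :=
    (isClosed_le ((Grass.continuous_proj n m).clm_apply continuous_const).norm
      continuous_const).measurableSet
  have h1 : grassMeasure h {V | ‖V.proj x‖ ≤ r * ‖x‖} =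
      orthHaar n {g | ‖(Grass.coordPlane h).proj ((g⁻¹).1 x)‖ ≤ r * ‖x‖} := by
    rw [grassMeasure, Measure.map_apply (Grass.continuous_rotate _).measurable hmeas]
    congr 1
    ext g
    simp only [mem_preimage, mem_ofPred_eq, Grass.norm_proj_rotate]
  have h2 : grassMeasure h {V | ‖V.proj x‖ ≤ r * ‖x‖} * v ≤ ENNReal.ofReal (2 ^ n * r ^ m) := by
    rw [h1, orthHaar_cone_mul_volume_ball _ _ hx]
    exact volume_coordPlane_slab_le h hr
  calc grassMeasure h {V | ‖V.proj x‖ ≤ r * ‖x‖}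
      ≤ ENNReal.ofReal (2 ^ n * r ^ m) / v := (ENNReal.le_div_iff_mul_le (.inl hv0) (.inl hvt)).2 h2
    _ = ENNReal.ofReal (2 ^ n * r ^ m / v.toReal) := by
        rw [ENNReal.ofReal_div_of_pos hvp, ENNReal.ofReal_toReal hvt]
    _ ≤ _ := by
        refine ENNReal.ofReal_le_ofReal ?_
        rw [mul_div_right_comm]
        gcongr
        exact le_max_right _ _

/-! ### Frostman-type covers of Hausdorff null sets -/

/-- A `σ`-dimensional Hausdorff null set carries, at each of its points, a large concentration of
some measure of arbitrarily small mass. The measure puts point masses into the sets of an efficient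
cover. Powers `r ^ σ` of dyadic radii `r = 2 ^ (-k)` are written as `(2 ^ (-σ)) ^ k`, here and
below. -/
theorem exists_measure_closedBall_ge {X : Type*} [MetricSpace X] [MeasurableSpace X] [BorelSpace X]
    {K : Set X} {σ : ℝ} (hσ : 0 < σ) (hK : Measure.hausdorffMeasure σ K = 0) (L : ℕ) :
    ∃ ν : Measure X, ν univ < ENNReal.ofReal (((1 / 2 : ℝ) ^ σ) ^ L) ∧
      ∀ x ∈ K, ∃ k : ℕ,
        ENNReal.ofReal (((1 / 2 : ℝ) ^ σ) ^ k) ≤ ν (Metric.closedBall x ((1 / 2) ^ k)) := by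
  set a : ℝ := (1 / 2 : ℝ) ^ σ with ha
  have ha0 : 0 < a := by positivity
  have ha1 : a < 1 := Real.rpow_lt_one (by norm_num) (by norm_num) hσ
  set ε : ENNReal := ENNReal.ofReal (a ^ (L + 1)) with hε
  have hεpos : 0 < ε := ENNReal.ofReal_pos.2 (by positivity)
  -- half of the mass is spent on the diameters, half on making the weights positive
  have hε2 : ε / 2 ≠ 0 := by simpa using hεpos.ne'
  have hcov : ∃ t : ℕ → Set X, K ⊆ ⋃ i, t i ∧ (∀ i, Metric.ediam (t i) ≤ 1) ∧
      ∑' i, (⨆ _ : (t i).Nonempty, Metric.ediam (t i) ^ σ) < ε / 2 := by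
    rw [Measure.hausdorffMeasure_apply] at hK
    have h1 := (iSup_eq_bot.1 hK) 1
    have h2 := (iSup_eq_bot.1 h1) one_pos
    have h3 := h2.trans_lt (pos_iff_ne_zero.2 hε2)
    simp only [iInf_lt_iff] at h3
    obtain ⟨t, ht, hd, hs⟩ := h3
    exact ⟨t, ht, hd, hs⟩
  obtain ⟨t, ht, hd, hs⟩ := hcov
  obtain ⟨e, he, hes⟩ := ENNReal.exists_pos_sum_of_countable hε2 ℕ
  -- a dyadic radius for each set of the cover
  have hk : ∀ i, ∃ k : ℕ, Metric.ediam (t i) ≤ ENNReal.ofReal ((1 / 2) ^ k) ∧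
      ENNReal.ofReal (a ^ (k + 1)) ≤ Metric.ediam (t i) ^ σ + e i := by
    intro i
    have hfin : Metric.ediam (t i) ≠ ⊤ := ((hd i).trans_lt ENNReal.one_lt_top).ne
    set D := (Metric.ediam (t i)).toReal with hD
    have hD1 : D ≤ 1 := ENNReal.toReal_le_of_le_ofReal zero_le_one (by simpa using hd i)
    have hD0 : 0 ≤ D := ENNReal.toReal_nonneg
    have hDe : Metric.ediam (t i) = ENNReal.ofReal D := (ENNReal.ofReal_toReal hfin).symm
    have hpow : ∀ k : ℕ, a ^ k = ((1 / 2 : ℝ) ^ k) ^ σ := fun k => by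
      rw [ha, ← Real.rpow_natCast, ← Real.rpow_mul (by norm_num), mul_comm, Real.rpow_mul
        (by norm_num), Real.rpow_natCast]
    rcases hD0.eq_or_lt with h0 | h0
    · have hlim := tendsto_pow_atTop_nhds_zero_of_lt_one ha0.le ha1
      obtain ⟨k, hk⟩ := (hlim.eventually (gt_mem_nhds (he i))).exists
      refine ⟨k, by rw [hDe, ← h0]; simp, ?_⟩
      refine le_add_of_le_right ?_
      rw [← ENNReal.ofReal_coe_nnreal]
      refine ENNReal.ofReal_le_ofReal (le_trans ?_ hk.le)
      exact pow_le_pow_of_le_one ha0.le ha1.le (Nat.le_succ k)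
    · obtain ⟨k, hk1, hk2⟩ := exists_nat_pow_near_of_lt_one h0 hD1 (by norm_num : (0 : ℝ) < 1 / 2)
        (by norm_num)
      refine ⟨k, by rw [hDe]; exact ENNReal.ofReal_le_ofReal hk2, ?_⟩
      refine le_add_of_le_left ?_
      rw [hDe, ENNReal.ofReal_rpow_of_nonneg hD0 hσ.le, hpow]
      exact ENNReal.ofReal_le_ofReal (Real.rpow_le_rpow (by positivity) hk1.le hσ.le)
  choose k hk1 hk2 using hk
  have hsum : ∑' i, ENNReal.ofReal (a ^ (k i + 1)) < ε := by
    refine (ENNReal.tsum_le_tsum hk2).trans_lt ?_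
    rw [ENNReal.tsum_add]
    have heq : ∀ i, Metric.ediam (t i) ^ σ = ⨆ _ : (t i).Nonempty, Metric.ediam (t i) ^ σ := by
      intro i
      rcases (t i).eq_empty_or_nonempty with h | h
      · simp [h, ENNReal.zero_rpow_of_pos hσ]
      · simp [h]
    rw [tsum_congr heq]
    calc _ < ε / 2 + ε / 2 := ENNReal.add_lt_add hs hes
      _ = ε := ENNReal.add_halves ε
  classical
  let ν : Measure X := Measure.sum fun i =>
    ENNReal.ofReal (a ^ k i) • (if h : (t i).Nonempty then Measure.dirac h.some else 0)
  have hapos : ENNReal.ofReal a ≠ 0 := (ENNReal.ofReal_pos.2 ha0).ne'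
  refine ⟨ν, ?_, fun x hx => ?_⟩
  · have h1 : ν univ ≤ ∑' i, ENNReal.ofReal (a ^ k i) := by
      rw [Measure.sum_apply _ MeasurableSet.univ]
      refine ENNReal.tsum_le_tsum fun i => ?_
      split_ifs <;> simp
    have h2 : ENNReal.ofReal a * ∑' i, ENNReal.ofReal (a ^ k i) < ENNReal.ofReal a *
        ENNReal.ofReal (a ^ L) := by
      rw [← ENNReal.tsum_mul_left, ← ENNReal.ofReal_mul ha0.le, ← pow_succ']
      refine lt_of_eq_of_lt (tsum_congr fun i => ?_) hsum
      rw [← ENNReal.ofReal_mul ha0.le, pow_succ']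
    exact h1.trans_lt ((ENNReal.mul_lt_mul_iff_right hapos ENNReal.ofReal_ne_top).1 h2)
  · obtain ⟨i, hi⟩ := mem_iUnion.1 (ht hx)
    have hne : (t i).Nonempty := ⟨x, hi⟩
    refine ⟨k i, ?_⟩
    have hmem : hne.some ∈ Metric.closedBall x ((1 / 2 : ℝ) ^ k i) := by
      rw [Metric.mem_closedBall, ← ENNReal.ofReal_le_ofReal_iff (by positivity), ← edist_dist]
      exact (Metric.edist_le_ediam_of_mem hne.some_mem hi).trans (hk1 i)
    rw [Measure.sum_apply _ Metric.isClosed_closedBall.measurableSet]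
    refine le_trans ?_ (ENNReal.le_tsum i)
    rw [dif_pos hne, Measure.smul_apply, Measure.dirac_apply_of_mem hmem, smul_eq_mul, mul_one]

/-- A `σ`-dimensional Hausdorff null set `K` can be covered at arbitrarily small dyadic scales `2 ^
(-k)`, `k > L`, by balls of radius `5 * 2 ^ (-k)` whose centres form a finite set `P k` that is at
most `σ`-dimensional at every scale between `1` and `2 ^ (-k)`. The points of `P k` are
chosen among those where `k` is the first scale at which the measure of
`exists_measure_closedBall_ge` is concentrated. -/
theorem exists_katzTao_cover {X : Type*} [MetricSpace X] [MeasurableSpace X] [BorelSpace X]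
    {K : Set X} {σ : ℝ} (hσ : 0 < σ) (hK : Measure.hausdorffMeasure σ K = 0) (L : ℕ) :
    ∃ P : ℕ → Finset X,
      (∀ k ≤ L, P k = ∅) ∧
      (∀ x ∈ K, ∃ k, ∃ p ∈ P k, dist x p ≤ 5 * (1 / 2) ^ k) ∧
      (∀ k, ((P k).card : ℝ) * ((1 / 2 : ℝ) ^ σ) ^ k ≤ 1) ∧
      (∀ k, ∀ p ∈ P k, ∀ j < k,
        (((P k).filter fun q => dist p q ≤ (1 / 2) ^ (j + 1)).card : ℝ) *
          ((1 / 2 : ℝ) ^ σ) ^ k ≤ ((1 / 2 : ℝ) ^ σ) ^ j) := by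
  obtain ⟨ν, hν, hball⟩ := exists_measure_closedBall_ge hσ hK L
  set a : ℝ := (1 / 2 : ℝ) ^ σ with ha
  have ha0 : 0 < a := by positivity
  have ha1 : a < 1 := Real.rpow_lt_one (by norm_num) (by norm_num) hσ
  have hν1 : ν univ < 1 := hν.trans_le (by
    rw [← ENNReal.ofReal_one]
    exact ENNReal.ofReal_le_ofReal (pow_le_one₀ ha0.le ha1.le))
  -- the points whose first scale of concentration is `k`
  let S : ℕ → Set X := fun k =>
    {x | ENNReal.ofReal (a ^ k) ≤ ν (Metric.closedBall x ((1 / 2) ^ k)) ∧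
      ∀ j < k, ν (Metric.closedBall x ((1 / 2) ^ j)) < ENNReal.ofReal (a ^ j)}
  have hvit := fun k => Vitali.exists_disjoint_subfamily_covering_enlargement_closedBall (S k)
    (fun x => x) (fun _ => (1 / 2 : ℝ) ^ k) ((1 / 2) ^ k) (fun _ _ => le_rfl) 5 (by norm_num)
  choose U hUS hUd hUc using hvit
  -- disjoint balls of mass at least `a ^ k` inside `B` number at most `ν B / a ^ k`
  have hcount : ∀ (k : ℕ) (Q : Finset X), (Q : Set X) ⊆ U k → ∀ B : Set X,
      (∀ q ∈ Q, Metric.closedBall q ((1 / 2) ^ k) ⊆ B) →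
      (Q.card : ENNReal) * ENNReal.ofReal (a ^ k) ≤ ν B := by
    intro k Q hQ B hB
    calc (Q.card : ENNReal) * ENNReal.ofReal (a ^ k)
        = ∑ _q ∈ Q, ENNReal.ofReal (a ^ k) := by rw [Finset.sum_const, nsmul_eq_mul]
      _ ≤ ∑ q ∈ Q, ν (Metric.closedBall q ((1 / 2) ^ k)) :=
          Finset.sum_le_sum fun q hq => (hUS k (hQ hq)).1
      _ = ν (⋃ q ∈ Q, Metric.closedBall q ((1 / 2) ^ k)) :=
          (measure_biUnion_finset ((hUd k).subset hQ)
            fun q _ => Metric.isClosed_closedBall.measurableSet).symm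
      _ ≤ ν B := measure_mono (iUnion₂_subset hB)
  have hcount' : ∀ (k : ℕ) (Q : Finset X), (Q : Set X) ⊆ U k → ∀ B : Set X,
      (∀ q ∈ Q, Metric.closedBall q ((1 / 2) ^ k) ⊆ B) → ∀ c : ℝ, 0 ≤ c →
      ν B ≤ ENNReal.ofReal c → (Q.card : ℝ) * a ^ k ≤ c := by
    intro k Q hQ B hB c hc hBc
    have h := (hcount k Q hQ B hB).trans hBc
    rwa [← ENNReal.ofReal_natCast, ← ENNReal.ofReal_mul (by positivity),
      ENNReal.ofReal_le_ofReal_iff hc] at h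
  have hone : ν univ ≤ ENNReal.ofReal 1 := by simpa using hν1.le
  have hfin : ∀ k, (U k).Finite := by
    intro k
    by_contra hinf
    obtain ⟨N, hN⟩ := exists_nat_gt (1 / a ^ k)
    obtain ⟨Q, hQ, hQN⟩ := (show (U k).Infinite from hinf).exists_subset_card_eq N
    have := hcount' k Q hQ univ (fun _ _ => subset_univ _) 1 zero_le_one hone
    rw [hQN, ← le_div_iff₀ (by positivity)] at this
    exact absurd this hN.not_ge
  refine ⟨fun k => (hfin k).toFinset, fun k hk => ?_, fun x hx => ?_, fun k => ?_, ?_⟩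
  · rw [Finite.toFinset_eq_empty]
    refine eq_empty_of_forall_notMem fun x hx => ?_
    have h1 := ((hUS k hx).1.trans (measure_mono (subset_univ _))).trans_lt hν
    rw [ENNReal.ofReal_lt_ofReal_iff (by positivity)] at h1
    exact h1.not_ge (pow_le_pow_of_le_one ha0.le ha1.le hk)
  · classical
    have hex := hball x hx
    have hxS : x ∈ S (Nat.find hex) :=
      ⟨Nat.find_spec hex, fun j hj => not_le.1 (Nat.find_min hex hj)⟩
    obtain ⟨p, hp, hsub⟩ := hUc _ x hxS
    refine ⟨_, p, (hfin _).mem_toFinset.2 hp, ?_⟩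
    exact Metric.mem_closedBall.1 (hsub (Metric.mem_closedBall_self (by positivity)))
  · exact hcount' k _ (by simp) univ (fun _ _ => subset_univ _) 1 zero_le_one hone
  · intro k p hp j hj
    rw [Finite.mem_toFinset] at hp
    refine hcount' k _ (fun q hq => ?_) (Metric.closedBall p ((1 / 2) ^ j)) (fun q hq => ?_) _
      (by positivity) ((hUS k hp).2 j hj).le
    · simpa using (Finset.mem_filter.1 (Finset.mem_coe.1 hq)).1
    · refine Metric.closedBall_subset_closedBall' ?_
      have h1 : (1 / 2 : ℝ) ^ k ≤ (1 / 2) ^ (j + 1) :=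
        pow_le_pow_of_le_one (by norm_num) (by norm_num) hj
      have h2 := (Finset.mem_filter.1 hq).2
      rw [dist_comm] at h2
      have h3 : (1 / 2 : ℝ) ^ (j + 1) + (1 / 2) ^ (j + 1) = (1 / 2) ^ j := by ring
      linarith

/-! ### Counting pairs of points with close projections -/

open Classical in
/-- The number of pairs `(p, q) ∈ P × P` whose projections to `V` are at distance at most `r`. -/
noncomputable def closePairs {n m : ℕ} (P : Finset (EuclideanSpace ℝ (Fin n))) (r : ℝ)
    (V : Grass n m) : ℕ :=
  ((P ×ˢ P).filter fun z => ‖V.proj (z.1 - z.2)‖ ≤ r).card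

theorem closePairs_mono {n m : ℕ} {P Q : Finset (EuclideanSpace ℝ (Fin n))} (h : Q ⊆ P) (r : ℝ)
    (V : Grass n m) : closePairs Q r V ≤ closePairs P r V :=
  Finset.card_le_card (Finset.filter_subset_filter _ (Finset.product_subset_product h h))

/-- A lower bound for the number of close pairs: if few balls cover the projection of `Q`, then many
points of `Q` share a ball (Cauchy–Schwarz). -/
theorem card_sq_le_card_mul_closePairs {n m : ℕ} (Q C : Finset (EuclideanSpace ℝ (Fin n))) (r : ℝ)
    (V : Grass n m) (h : ∀ q ∈ Q, ∃ c ∈ C, dist (V.proj q) c ≤ r) :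
    Q.card ^ 2 ≤ C.card * closePairs Q (2 * r) V := by
  classical
  choose! f hfC hf using h
  have h1 : Q.card = ∑ c ∈ C, (Q.filter fun q => f q = c).card :=
    Finset.card_eq_sum_card_fiberwise hfC
  have h2 : ∑ c ∈ C, (Q.filter fun q => f q = c).card ^ 2 ≤ closePairs Q (2 * r) V := by
    have hdisj : (C : Set (EuclideanSpace ℝ (Fin n))).PairwiseDisjoint
        fun c => (Q.filter fun q => f q = c) ×ˢ (Q.filter fun q => f q = c) := by
      intro c _ c' _ hcc'
      refine Finset.disjoint_left.2 fun z hz hz' => hcc' ?_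
      simp only [Finset.mem_product, Finset.mem_filter] at hz hz'
      rw [← hz.1.2, hz'.1.2]
    have h3 : ∑ c ∈ C, (Q.filter fun q => f q = c).card ^ 2 =
        (C.biUnion fun c => (Q.filter fun q => f q = c) ×ˢ (Q.filter fun q => f q = c)).card := by
      rw [Finset.card_biUnion hdisj]
      exact Finset.sum_congr rfl fun c _ => by rw [Finset.card_product, sq]
    rw [h3]
    refine Finset.card_le_card fun z hz => ?_
    simp only [Finset.mem_biUnion, Finset.mem_product, Finset.mem_filter] at hz ⊢
    obtain ⟨c, -, ⟨h1, h1c⟩, h2, h2c⟩ := hz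
    refine ⟨⟨h1, h2⟩, ?_⟩
    have e1 := hf _ h1
    have e2 := hf _ h2
    rw [h1c] at e1
    rw [h2c] at e2
    rw [map_sub, ← dist_eq_norm]
    linarith [dist_triangle_right (V.proj z.1) (V.proj z.2) c]
  calc Q.card ^ 2 = (∑ c ∈ C, (Q.filter fun q => f q = c).card) ^ 2 := by rw [← h1]
    _ ≤ C.card * ∑ c ∈ C, (Q.filter fun q => f q = c).card ^ 2 := by
      simpa using sq_sum_le_card_mul_sum_sq (s := C)
        (f := fun c => (Q.filter fun q => f q = c).card)
    _ ≤ _ := Nat.mul_le_mul_left _ h2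

theorem measurableSet_norm_proj_le {n m : ℕ} (x : EuclideanSpace ℝ (Fin n)) (r : ℝ) :
    MeasurableSet {V : Grass n m | ‖V.proj x‖ ≤ r} :=
  (isClosed_le ((Grass.continuous_proj n m).clm_apply continuous_const).norm
    continuous_const).measurableSet

theorem closePairs_eq_sum {n m : ℕ} (P : Finset (EuclideanSpace ℝ (Fin n))) (r : ℝ)
    (V : Grass n m) : (closePairs P r V : ENNReal) =
      ∑ p ∈ P, ∑ q ∈ P, {V : Grass n m | ‖V.proj (p - q)‖ ≤ r}.indicator 1 V := by
  classical
  rw [closePairs, Finset.card_filter, Nat.cast_sum, Finset.sum_product]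
  refine Finset.sum_congr rfl fun p _ => Finset.sum_congr rfl fun q _ => ?_
  simp [indicator_apply]

/-- Transversality at scale `2 ^ (-k)`, sorted by the dyadic size of `p - q` and weakened from the
exponent `m` to `τ ≤ m`. -/
theorem exists_grassMeasure_close_le {n m : ℕ} (h : m ≤ n) {τ : ℝ} (hτm : τ ≤ m) :
    ∃ C : ℝ, 0 ≤ C ∧ ∀ (k : ℕ) (p q : EuclideanSpace ℝ (Fin n)),
      grassMeasure h {V | ‖V.proj (p - q)‖ ≤ 12 * (1 / 2) ^ k} ≤
        ENNReal.ofReal (C * (((1 / 2 : ℝ) ^ τ) ^ k + ∑ j ∈ Finset.range k,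
          if dist p q ≤ (1 / 2) ^ (j + 1) then ((1 / 2 : ℝ) ^ τ) ^ (k - (j + 1)) else 0)) := by
  classical
  obtain ⟨C, hC1, hC⟩ := exists_grassMeasure_cone_le (n := n) (m := m) h
  set b : ℝ := (1 / 2 : ℝ) ^ τ with hb
  have hb0 : 0 < b := by positivity
  have hb1 : (1 / 2 : ℝ) ^ m ≤ b := by
    rw [hb, ← Real.rpow_natCast]
    exact Real.rpow_le_rpow_of_exponent_ge (by norm_num) (by norm_num) hτm
  refine ⟨C * 24 ^ m, by positivity, fun k p q => ?_⟩
  have hCm : 1 ≤ C * 24 ^ m := one_le_mul_of_one_le_of_one_le hC1 (one_le_pow₀ (by norm_num))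
  set i := Nat.findGreatest (fun i => i = 0 ∨ dist p q ≤ (1 / 2) ^ i) k with hi
  have hik : i ≤ k := Nat.findGreatest_le k
  have hspec : i = 0 ∨ dist p q ≤ (1 / 2) ^ i :=
    Nat.findGreatest_spec (P := fun i => i = 0 ∨ dist p q ≤ (1 / 2) ^ i) (Nat.zero_le k) (.inl rfl)
  -- only the term of the sum with `j + 1 = i` is kept, or the first one if `i = 0`
  have hterm : b ^ (k - i) ≤ b ^ k + ∑ j ∈ Finset.range k,
      if dist p q ≤ (1 / 2) ^ (j + 1) then b ^ (k - (j + 1)) else 0 := by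
    have hnn : ∀ j ∈ Finset.range k,
        0 ≤ if dist p q ≤ (1 / 2) ^ (j + 1) then b ^ (k - (j + 1)) else 0 :=
      fun j _ => by split_ifs <;> positivity
    rcases Nat.eq_zero_or_pos i with h0 | h0
    · rw [h0, Nat.sub_zero]
      exact le_add_of_nonneg_right (Finset.sum_nonneg hnn)
    · obtain ⟨j, hj⟩ := Nat.exists_eq_add_one.2 h0
      have hd := hspec.resolve_left h0.ne'
      rw [hj] at hd hik ⊢
      have := Finset.single_le_sum hnn (Finset.mem_range.2 hik)
      rw [if_pos hd] at this
      exact this.trans (le_add_of_nonneg_left (by positivity))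
  refine le_trans ?_ (ENNReal.ofReal_le_ofReal (mul_le_mul_of_nonneg_left hterm (by positivity)))
  rcases hik.eq_or_lt with hk | hk
  · rw [hk, Nat.sub_self, pow_zero, mul_one]
    exact prob_le_one.trans (by simpa using hCm)
  · have hgt : (1 / 2 : ℝ) ^ (i + 1) < dist p q := by
      have := Nat.findGreatest_is_greatest (P := fun i => i = 0 ∨ dist p q ≤ (1 / 2) ^ i)
        (Nat.lt_succ_self i) hk
      push Not at this
      exact this.2
    have hne : p - q ≠ 0 := sub_ne_zero.2 (dist_pos.1 (lt_trans (by positivity) hgt))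
    rw [dist_eq_norm] at hgt
    have hpow : (1 / 2 : ℝ) ^ k = (1 / 2) ^ (k - i) * (1 / 2) ^ i := by
      rw [← pow_add, Nat.sub_add_cancel hik]
    refine (measure_mono fun V hV => ?_).trans ((hC (p - q) hne (24 * (1 / 2) ^ (k - i))
      (by positivity)).trans (ENNReal.ofReal_le_ofReal ?_))
    · refine le_trans (mem_ofPred_eq ▸ hV) ?_
      calc (12 : ℝ) * (1 / 2) ^ k = 24 * (1 / 2) ^ (k - i) * (1 / 2) ^ (i + 1) := by
            rw [hpow]; ring
        _ ≤ _ := by gcongr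
    · rw [mul_pow, ← mul_assoc, ← pow_mul, mul_comm (k - i), pow_mul]
      gcongr

/-- The discrete energy estimate: for a set `P` of at most `2 ^ (k σ)` points that is at most
`σ`-dimensional between the scales `1` and `2 ^ (-k)`, planes `V` for which many pairs in `P` have
projections within `12 * 2 ^ (-k)` of each other are rare. -/
theorem exists_grassMeasure_closePairs_le {n m : ℕ} (h : m ≤ n) {σ τ : ℝ} (hτ : 0 < τ)
    (hτm : τ ≤ m) (hτσ : τ ≤ σ) :
    ∃ C : ℝ, 0 ≤ C ∧ ∀ (k : ℕ) (P : Finset (EuclideanSpace ℝ (Fin n))),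
      ((P.card : ℝ) * ((1 / 2 : ℝ) ^ σ) ^ k ≤ 1) →
      (∀ p ∈ P, ∀ j < k, ((P.filter fun q => dist p q ≤ (1 / 2) ^ (j + 1)).card : ℝ) *
          ((1 / 2 : ℝ) ^ σ) ^ k ≤ ((1 / 2 : ℝ) ^ σ) ^ j) →
      ∀ T : ℝ, 0 < T →
        grassMeasure h {V | T ≤ closePairs P (12 * (1 / 2) ^ k) V} ≤
          ENNReal.ofReal (C * (k + 1) *
            ((1 / 2 : ℝ) ^ τ / ((1 / 2 : ℝ) ^ σ) ^ 2) ^ k / T) := by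
  classical
  obtain ⟨C, hC0, hC⟩ := exists_grassMeasure_close_le (n := n) (m := m) h hτm
  set a : ℝ := (1 / 2 : ℝ) ^ σ with ha
  set b : ℝ := (1 / 2 : ℝ) ^ τ with hb
  have ha0 : 0 < a := by positivity
  have hb0 : 0 < b := by positivity
  have hb1 : b ≤ 1 := Real.rpow_le_one (by norm_num) (by norm_num) hτ.le
  have hab : a ≤ b := Real.rpow_le_rpow_of_exponent_ge (by norm_num) (by norm_num) hτσ
  refine ⟨C / b, by positivity, fun k P hP hPj T hT => ?_⟩
  set M : ℝ := C / b * (k + 1) * (b / a ^ 2) ^ k with hM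
  have hPk : (P.card : ℝ) ≤ 1 / a ^ k := (le_div_iff₀ (by positivity)).2 hP
  -- the contribution of one point
  have hpoint : ∀ p ∈ P, ∑ q ∈ P, C * (b ^ k + ∑ j ∈ Finset.range k,
      if dist p q ≤ (1 / 2) ^ (j + 1) then b ^ (k - (j + 1)) else 0) ≤
        C / b * (k + 1) * (b / a) ^ k := by
    intro p hp
    have hba1 : 1 ≤ b / a := (one_le_div ha0).2 hab
    have hx : (P.card : ℝ) * b ^ k ≤ 1 / b * (b / a) ^ k := by
      calc (P.card : ℝ) * b ^ k ≤ 1 / a ^ k * b ^ k := by gcongr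
        _ = 1 * (b / a) ^ k := by rw [div_pow]; ring
        _ ≤ _ := by
          gcongr
          exact (one_le_div hb0).2 hb1
    have hy : ∀ j ∈ Finset.range k, ∑ q ∈ P,
        (if dist p q ≤ (1 / 2) ^ (j + 1) then b ^ (k - (j + 1)) else 0) ≤
          1 / b * (b / a) ^ k := by
      intro j hj
      have hjk := Finset.mem_range.1 hj
      rw [← Finset.sum_filter, Finset.sum_const, nsmul_eq_mul]
      have e1 : (k - (j + 1)) + 1 = k - j := by omega
      have hak : a ^ k = a ^ (k - j) * a ^ j := by
        rw [← pow_add, Nat.sub_add_cancel hjk.le]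
      have h1 : ((P.filter fun q => dist p q ≤ (1 / 2) ^ (j + 1)).card : ℝ) ≤ 1 / a ^ (k - j) := by
        rw [le_div_iff₀ (by positivity)]
        have := hPj p hp j hjk
        rw [hak, ← mul_assoc] at this
        exact le_of_mul_le_mul_right (by simpa using this) (by positivity : 0 < a ^ j)
      calc _ ≤ 1 / a ^ (k - j) * b ^ (k - (j + 1)) := by gcongr
        _ = 1 / b * (b / a) ^ (k - j) := by
          rw [div_pow, ← e1, pow_succ b]
          field_simp
        _ ≤ 1 / b * (b / a) ^ k := by
          gcongr
          exact Nat.sub_le _ _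
    rw [← Finset.mul_sum, Finset.sum_add_distrib, Finset.sum_const, nsmul_eq_mul, Finset.sum_comm]
    have hz := Finset.sum_le_card_nsmul _ _ _ hy
    rw [Finset.card_range, nsmul_eq_mul] at hz
    calc _ ≤ C * (1 / b * (b / a) ^ k + k * (1 / b * (b / a) ^ k)) := by gcongr
      _ = _ := by ring
  have hint : ∫⁻ V, (closePairs P (12 * (1 / 2) ^ k) V : ENNReal) ∂(grassMeasure h) ≤
      ENNReal.ofReal M := by
    simp only [closePairs_eq_sum]
    have hmeas : ∀ p q : EuclideanSpace ℝ (Fin n), Measurable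
        ({V : Grass n m | ‖V.proj (p - q)‖ ≤ 12 * (1 / 2) ^ k}.indicator
          (1 : Grass n m → ENNReal)) :=
      fun p q => measurable_one.indicator (measurableSet_norm_proj_le _ _)
    rw [lintegral_finsetSum _ fun p _ => Finset.measurable_sum _ fun q _ => hmeas p q]
    have hnn : ∀ p q : EuclideanSpace ℝ (Fin n), 0 ≤ C * (b ^ k + ∑ j ∈ Finset.range k,
        if dist p q ≤ (1 / 2) ^ (j + 1) then b ^ (k - (j + 1)) else 0) := fun p q =>
      mul_nonneg hC0 (add_nonneg (by positivity)
        (Finset.sum_nonneg fun j _ => by split_ifs <;> positivity))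
    calc _ ≤ ∑ p ∈ P, ENNReal.ofReal (C / b * (k + 1) * (b / a) ^ k) := by
          refine Finset.sum_le_sum fun p hp => ?_
          rw [lintegral_finsetSum _ fun q _ => hmeas p q]
          refine le_trans ?_ (ENNReal.ofReal_le_ofReal (hpoint p hp))
          rw [ENNReal.ofReal_sum_of_nonneg fun q _ => hnn p q]
          refine Finset.sum_le_sum fun q _ => ?_
          rw [lintegral_indicator_one (measurableSet_norm_proj_le _ _)]
          exact hC k p q
      _ = ENNReal.ofReal (P.card * (C / b * (k + 1) * (b / a) ^ k)) := by
          rw [Finset.sum_const, nsmul_eq_mul, ENNReal.ofReal_mul (Nat.cast_nonneg P.card),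
            ENNReal.ofReal_natCast]
      _ ≤ ENNReal.ofReal M := by
          refine ENNReal.ofReal_le_ofReal ?_
          calc _ ≤ 1 / a ^ k * (C / b * (k + 1) * (b / a) ^ k) := by gcongr
            _ = M := by
              rw [hM, div_pow, div_pow, ← pow_mul, mul_comm 2 k, pow_mul]
              field_simp
  have hmeasf : Measurable fun V : Grass n m =>
      (closePairs P (12 * (1 / 2) ^ k) V : ENNReal) := by
    simp only [closePairs_eq_sum]
    exact Finset.measurable_sum _ fun p _ => Finset.measurable_sum _ fun q _ =>
      measurable_one.indicator (measurableSet_norm_proj_le _ _)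
  have hmk := (mul_meas_ge_le_lintegral (μ := grassMeasure h) hmeasf (ENNReal.ofReal T)).trans hint
  have hset : {V : Grass n m | T ≤ closePairs P (12 * (1 / 2) ^ k) V} =
      {V | ENNReal.ofReal T ≤ (closePairs P (12 * (1 / 2) ^ k) V : ENNReal)} := by
    ext V
    rw [mem_ofPred_eq, mem_ofPred_eq, ← ENNReal.ofReal_natCast,
      ENNReal.ofReal_le_ofReal_iff (by positivity)]
  rw [hset, ENNReal.ofReal_div_of_pos hT, ENNReal.le_div_iff_mul_le
    (.inl (ENNReal.ofReal_pos.2 hT).ne') (.inl ENNReal.ofReal_ne_top), mul_comm]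
  exact hmk

/-! ### Exceptional planes -/

/-- If `γ (B L) → 0`, then almost every `V` avoids `B L` for infinitely many `L`. -/
theorem ae_frequently_notMem_of_tendsto {α : Type*} [MeasurableSpace α] {μ : Measure α}
    {B : ℕ → Set α} (h : Tendsto (fun L => μ (B L)) atTop (𝓝 0)) :
    ∀ᵐ x ∂μ, ∃ᶠ L in atTop, x ∉ B L := by
  have hsub : {x | ¬ ∃ᶠ L in atTop, x ∉ B L} ⊆ ⋃ L₀ : ℕ, ⋂ L ≥ L₀, B L := by
    intro x hx
    simp only [mem_ofPred_eq, not_frequently, not_not, eventually_atTop] at hx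
    simpa using hx
  refine measure_mono_null hsub (measure_iUnion_null fun L₀ => ?_)
  refine le_antisymm (ge_of_tendsto h ?_) zero_le
  filter_upwards [eventually_ge_atTop L₀] with L hL
  exact measure_mono (biInter_subset_of_mem hL)

/-- Let `K` be a `σ`-dimensional null set. For almost every `V`, any subset `A ⊆ K`, possibly
depending on `V`, whose projection is covered by `2 ^ (k t)` balls of radius `2 ^ (-k)` for all
large `k`, is an `s`-dimensional null set, provided that `s` is close to `σ`. The exponent `β < s`
marks the border between few and many points: a part of `P k` is large if it has at least `2 ^ (k
β)` points. -/
theorem ae_hausdorffMeasure_eq_zero {n m : ℕ} (h : m ≤ n) {σ τ t β s : ℝ} (hτ : 0 < τ)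
    (hτm : τ ≤ m) (hτσ : τ ≤ σ) (hβ : 2 * (σ - β) < τ - t) (hs0 : 0 ≤ s) (hs : β < s)
    {K : Set (EuclideanSpace ℝ (Fin n))} (hK : Measure.hausdorffMeasure σ K = 0) :
    ∀ᵐ V ∂(grassMeasure h), ∀ A ⊆ K, ∀ k₀ : ℕ,
      (∀ k ≥ k₀, ∃ C : Finset (EuclideanSpace ℝ (Fin n)),
        (C.card : ℝ) * ((1 / 2 : ℝ) ^ t) ^ k ≤ 1 ∧
          V.proj '' A ⊆ ⋃ c ∈ C, Metric.ball c ((1 / 2) ^ k)) →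
      Measure.hausdorffMeasure s A = 0 := by
  classical
  obtain ⟨M, hM0, hM⟩ := exists_grassMeasure_closePairs_le (n := n) (m := m) h hτ hτm hτσ
  choose P hPe hPc hPcard hPj using exists_katzTao_cover (hτ.trans_le hτσ) hK
  set a : ℝ := (1 / 2 : ℝ) ^ σ with ha
  set b : ℝ := (1 / 2 : ℝ) ^ τ with hb
  set c : ℝ := (1 / 2 : ℝ) ^ β with hc
  set d : ℝ := (1 / 2 : ℝ) ^ t with hd
  set e : ℝ := (1 / 2 : ℝ) ^ s with he
  have ha0 : 0 < a := by positivity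
  have hb0 : 0 < b := by positivity
  have hc0 : 0 < c := by positivity
  have hd0 : 0 < d := by positivity
  have he0 : 0 < e := by positivity
  -- the threshold for the number of close pairs is `T ^ k`, and the exceptional sets have
  -- measure at most a constant times `(k + 1) * ρ ^ k`
  set T : ℝ := d / c ^ 2 with hT
  set ρ : ℝ := b / a ^ 2 / T with hρ
  have hT0 : 0 < T := by positivity
  have hρ0 : 0 < ρ := by positivity
  have hρ1 : ρ < 1 := by
    have hρe : ρ = (1 / 2 : ℝ) ^ (τ + 2 * β - 2 * σ - t) := by
      have e2 : ∀ x : ℝ, ((1 / 2 : ℝ) ^ x) ^ 2 = (1 / 2 : ℝ) ^ (2 * x) := fun x => by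
        rw [← Real.rpow_natCast, ← Real.rpow_mul (by norm_num)]
        ring_nf
      rw [Real.rpow_sub (by norm_num), Real.rpow_sub (by norm_num), Real.rpow_add (by norm_num),
        ← e2, ← e2, hρ, hT]
      field_simp
      rw [← hb, ← hc, ← hd, ← ha]
      field_simp
    rw [hρe]
    exact Real.rpow_lt_one (by norm_num) (by norm_num) (by linarith)
  let f : ℕ → ENNReal := fun k => ENNReal.ofReal (M * (k + 1) * (b / a ^ 2) ^ k / T ^ k)
  have hf : ∑' k, f k ≠ ⊤ := by
    have h1 : Summable fun k : ℕ => M * (k + 1) * (b / a ^ 2) ^ k / T ^ k := by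
      have h2 := summable_pow_mul_geometric_of_norm_lt_one 1
        (r := ρ) (by rwa [Real.norm_of_nonneg hρ0.le])
      have h3 := summable_geometric_of_lt_one hρ0.le hρ1
      refine ((h2.add h3).mul_left M).congr fun k => ?_
      rw [hρ, div_pow _ T]
      ring
    exact h1.tsum_ofReal_ne_top
  let B : ℕ → Set (Grass n m) := fun L =>
    ⋃ k, {V | T ^ (k + L) ≤ closePairs (P L (k + L)) (12 * (1 / 2) ^ (k + L)) V}
  have hB : Tendsto (fun L => grassMeasure h (B L)) atTop (𝓝 0) := by
    refine tendsto_of_tendsto_of_tendsto_of_le_of_le tendsto_const_nhds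
      (ENNReal.tendsto_sum_nat_add f hf) (fun _ => zero_le) fun L => ?_
    refine (measure_iUnion_le _).trans (ENNReal.tsum_le_tsum fun k => ?_)
    exact hM (k + L) (P L (k + L)) (hPcard L _) (hPj L _) _ (by positivity)
  filter_upwards [ae_frequently_notMem_of_tendsto hB] with V hV A hAK k₀ hA
  -- outside `B L`, few balls of the cover meet `A`
  let Q : ℕ → ℕ → Finset (EuclideanSpace ℝ (Fin n)) := fun L k =>
    (P L k).filter fun p => ∃ x ∈ A, dist x p ≤ 5 * (1 / 2) ^ k
  have hQ : ∀ L ≥ k₀, V ∉ B L → ∀ k, ((Q L (k + L)).card : ℝ) * c ^ (k + L) < 1 := by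
    intro L hL hVB k
    by_contra! hcon
    refine hVB (mem_iUnion.2 ⟨k, ?_⟩)
    obtain ⟨C, hC, hAC⟩ := hA (k + L) (by omega)
    set l := k + L with hl
    have h1 := card_sq_le_card_mul_closePairs (Q L l) C (6 * (1 / 2) ^ l) V (by
      intro q hq
      obtain ⟨-, x, hx, hxq⟩ := Finset.mem_filter.1 hq
      obtain ⟨y, hy, hxy⟩ := mem_iUnion₂.1 (hAC (mem_image_of_mem _ hx))
      refine ⟨y, hy, ?_⟩
      have h2 : dist (V.proj q) (V.proj x) ≤ dist x q := by
        rw [dist_comm x, dist_eq_norm, dist_eq_norm, ← map_sub]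
        exact Submodule.norm_starProjection_apply_le _ _
      have h3 := Metric.mem_ball.1 hxy
      linarith [dist_triangle (V.proj q) (V.proj x) y])
    have h2 := h1.trans (Nat.mul_le_mul_left _
      (closePairs_mono (Finset.filter_subset _ (P L l)) _ V))
    rw [← mul_assoc, show (2 * 6 : ℝ) = 12 by norm_num] at h2
    have h3 : ((Q L l).card : ℝ) ^ 2 ≤
      C.card * closePairs (P L l) (12 * (1 / 2) ^ l) V := by exact_mod_cast h2
    rw [mem_ofPred_eq]
    have h4 : (1 : ℝ) ≤ ((Q L l).card * c ^ l) ^ 2 := one_le_pow₀ hcon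
    calc T ^ l = d ^ l * 1 / (c ^ l) ^ 2 := by
          rw [hT, div_pow, ← pow_mul, ← pow_mul, mul_comm 2 l, mul_one]
      _ ≤ d ^ l * ((Q L l).card * c ^ l) ^ 2 / (c ^ l) ^ 2 := by gcongr
      _ = d ^ l * (Q L l).card ^ 2 := by field_simp
      _ ≤ d ^ l * (C.card * closePairs (P L l) (12 * (1 / 2) ^ l) V) := by gcongr
      _ = (C.card * d ^ l) * closePairs (P L l) (12 * (1 / 2) ^ l) V := by ring
      _ ≤ 1 * closePairs (P L l) (12 * (1 / 2) ^ l) V := by gcongr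
      _ = _ := one_mul _
  -- hence these balls have a small `s`-dimensional sum
  let g : ℕ → ENNReal := fun k => ENNReal.ofReal (10 ^ s * (e / c) ^ k)
  have hg : ∑' k, g k ≠ ⊤ := by
    have hec : e / c < 1 := by
      rw [div_lt_one hc0]
      exact Real.rpow_lt_rpow_of_exponent_gt (by norm_num) (by norm_num) hs
    exact ((summable_geometric_of_lt_one (by positivity) hec).mul_left _).tsum_ofReal_ne_top
  let F : Filter ℕ := atTop ⊓ 𝓟 {L | V ∉ B L}
  have hFne : F.NeBot := frequently_mem_iff_neBot.1 hV
  have hFle : F ≤ atTop := inf_le_left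
  have hFB : ∀ᶠ L in F, V ∉ B L ∧ k₀ ≤ L :=
    (eventually_inf_principal.2 (Eventually.of_forall fun _ hL => hL)).and
      (hFle (eventually_ge_atTop k₀))
  have hdiam : ∀ (k : ℕ) (p : EuclideanSpace ℝ (Fin n)),
      Metric.ediam (Metric.closedBall p (5 * (1 / 2) ^ k)) ≤ ENNReal.ofReal (10 * (1 / 2) ^ k) := by
    intro k p
    refine Metric.ediam_le fun x hx y hy => ?_
    rw [edist_dist]
    refine ENNReal.ofReal_le_ofReal ?_
    linarith [dist_triangle_right x y p, Metric.mem_closedBall.1 hx, Metric.mem_closedBall.1 hy]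
  have hlim : Tendsto (fun L : ℕ => ENNReal.ofReal (10 * (1 / 2) ^ L)) F (𝓝 0) := by
    refine Tendsto.mono_left ?_ hFle
    have := (tendsto_pow_atTop_nhds_zero_of_lt_one (r := (1 / 2 : ℝ)) (by norm_num)
      (by norm_num)).const_mul 10
    simpa using ENNReal.tendsto_ofReal this
  have hmain := Measure.hausdorffMeasure_le_liminf_tsum (l := F)
    (ι := fun L => Σ k : ℕ, {q // q ∈ Q L (k + L)}) s A
    (fun L => ENNReal.ofReal (10 * (1 / 2) ^ L)) hlim
    (fun L i => Metric.closedBall i.2.1 (5 * (1 / 2) ^ (i.1 + L)))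
    (Eventually.of_forall fun L i => (hdiam _ _).trans (ENNReal.ofReal_le_ofReal (by
      have : (1 / 2 : ℝ) ^ (i.1 + L) ≤ (1 / 2) ^ L :=
        pow_le_pow_of_le_one (by norm_num) (by norm_num) (Nat.le_add_left _ _)
      linarith)))
    (Eventually.of_forall fun L x hx => by
      obtain ⟨k, p, hp, hxp⟩ := hPc L x (hAK hx)
      have hLk : L ≤ k := by
        by_contra! hlt
        rw [hPe L k hlt.le] at hp
        exact absurd hp (Finset.notMem_empty p)
      obtain ⟨j, rfl⟩ := Nat.exists_eq_add_of_le' hLk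
      exact mem_iUnion.2 ⟨⟨j, p, Finset.mem_filter.2 ⟨hp, x, hx, hxp⟩⟩, hxp⟩)
  have hzero : Tendsto (fun L => ∑' i : (Σ k : ℕ, {q // q ∈ Q L (k + L)}),
      Metric.ediam (Metric.closedBall i.2.1 (5 * (1 / 2 : ℝ) ^ (i.1 + L))) ^ s) F (𝓝 0) := by
    refine tendsto_of_tendsto_of_tendsto_of_le_of_le' tendsto_const_nhds
      ((ENNReal.tendsto_sum_nat_add g hg).mono_left hFle) (Eventually.of_forall fun _ => zero_le) ?_
    filter_upwards [hFB] with L hL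
    rw [ENNReal.tsum_sigma']
    refine ENNReal.tsum_le_tsum fun k => ?_
    have hQk := hQ L hL.2 hL.1 k
    set l := k + L
    calc ∑' q : {q // q ∈ Q L l}, Metric.ediam (Metric.closedBall q.1 (5 * (1 / 2 : ℝ) ^ l)) ^ s
        ≤ ∑' _q : {q // q ∈ Q L l}, ENNReal.ofReal (10 * (1 / 2) ^ l) ^ s :=
          ENNReal.tsum_le_tsum fun q => ENNReal.rpow_le_rpow (hdiam _ _) hs0
      _ = ENNReal.ofReal ((Q L l).card * (10 * (1 / 2) ^ l) ^ s) := by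
          rw [tsum_fintype, Finset.sum_const, Finset.card_univ, Fintype.card_coe, nsmul_eq_mul,
            ENNReal.ofReal_rpow_of_nonneg (by positivity) hs0,
            ENNReal.ofReal_mul (Nat.cast_nonneg (Q L l).card),
            ENNReal.ofReal_natCast]
      _ ≤ g l := by
          refine ENNReal.ofReal_le_ofReal ?_
          have e1 : (((1 / 2 : ℝ)) ^ l) ^ s = e ^ l := by
            rw [he, ← Real.rpow_natCast, ← Real.rpow_mul (by norm_num), mul_comm, Real.rpow_mul
              (by norm_num), Real.rpow_natCast]
          rw [Real.mul_rpow (by norm_num) (by positivity), e1, div_pow]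
          have h1 : ((Q L l).card : ℝ) ≤ 1 / c ^ l := (le_div_iff₀ (by positivity)).2 hQk.le
          calc _ ≤ 1 / c ^ l * (10 ^ s * e ^ l) := by gcongr
            _ = _ := by ring
  rw [hzero.liminf_eq] at hmain
  exact le_antisymm hmain zero_le

/-! ### From box counting to packing dimension -/

theorem exists_forall_coverNum_le {n : ℕ} {F : Set (EuclideanSpace ℝ (Fin n))} {t : ℝ}
    (hF : upperBoxDim F < ENNReal.ofReal t) :
    ∃ k₀ : ℕ, ∀ k ≥ k₀, (coverNum F ((1 / 2) ^ k) : ℝ) * ((1 / 2 : ℝ) ^ t) ^ k ≤ 1 := by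
  have h1 := eventually_lt_of_limsup_lt hF
  have h2 : Tendsto (fun k : ℕ => (1 / 2 : ℝ) ^ k) atTop (𝓝[>] 0) :=
    tendsto_pow_atTop_nhdsWithin_zero_of_lt_one (by norm_num) (by norm_num)
  obtain ⟨k₀, hk₀⟩ := eventually_atTop.1 ((h2.eventually h1).and (eventually_gt_atTop 0))
  refine ⟨k₀, fun k hk => ?_⟩
  obtain ⟨h3, hk0⟩ := hk₀ k hk
  rcases Nat.eq_zero_or_pos (coverNum F ((1 / 2) ^ k)) with h0 | h0
  · rw [h0, Nat.cast_zero, zero_mul]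
    exact zero_le_one
  · have h4 := (ENNReal.ofReal_lt_ofReal_iff_of_nonneg (by
      refine div_nonneg (Real.log_natCast_nonneg _) ?_
      rw [neg_nonneg]
      exact Real.log_nonpos (by positivity) (pow_le_one₀ (by norm_num) (by norm_num)))).1 h3
    have hlog : 0 < -Real.log ((1 / 2 : ℝ) ^ k) :=
      neg_pos.2 (Real.log_neg (by positivity) (pow_lt_one₀ (by norm_num) (by norm_num) hk0.ne'))
    rw [div_lt_iff₀ hlog] at h4
    have hN : (0 : ℝ) < coverNum F ((1 / 2) ^ k) := by exact_mod_cast h0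
    have e1 : Real.log (((1 / 2 : ℝ) ^ t) ^ k) = t * Real.log ((1 / 2 : ℝ) ^ k) := by
      rw [Real.log_pow, Real.log_pow, Real.log_rpow (by norm_num)]
      ring
    rw [← Real.log_nonpos_iff (by positivity), Real.log_mul hN.ne' (by positivity), e1]
    linarith

/-- The projection theorem below a fixed level `t < min (dimH K) m`. -/
theorem ae_not_packingDim_lt {n m : ℕ} (h : m ≤ n) (K : Set (EuclideanSpace ℝ (Fin n)))
    (t : NNReal) (ht : (t : ENNReal) < min (dimH K) m) :
    ∀ᵐ V ∂(grassMeasure h), ¬ packingDim (V.proj '' K) < t := by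
  have hfin : dimH K ≠ ⊤ := by
    refine ((dimH_mono (subset_univ K)).trans_lt ?_).ne
    rw [Real.dimH_univ_eq_finrank]
    exact ENNReal.natCast_lt_top _
  lift dimH K to NNReal using hfin with d hd
  obtain ⟨τ, htτ, hτ⟩ := ENNReal.lt_iff_exists_nnreal_btwn.1 ht
  rw [lt_min_iff] at hτ
  have hτd : (τ : ℝ) < d := by exact_mod_cast hτ.1
  have hτm : (τ : ℝ) < m := by exact_mod_cast hτ.2
  have htτ' : (t : ℝ) < τ := by exact_mod_cast htτ
  have ht0 : (0 : ℝ) ≤ t := t.2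
  set η : ℝ := (τ - t) / 8 with hη
  have hη0 : 0 < η := by rw [hη]; linarith
  have h8 : 8 * η = τ - t := by rw [hη]; ring
  have hσ : Measure.hausdorffMeasure ((d : ℝ) + η) K = 0 := by
    rw [← Real.coe_toNNReal ((d : ℝ) + η) (by positivity)]
    refine hausdorffMeasure_of_dimH_lt ?_
    rw [← hd, ENNReal.coe_lt_coe, Real.lt_toNNReal_iff_coe_lt]
    exact lt_add_of_pos_right _ hη0
  have hs : Measure.hausdorffMeasure ((d : ℝ) - η) K = ⊤ := by
    rw [← Real.coe_toNNReal ((d : ℝ) - η) (by linarith)]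
    refine hausdorffMeasure_of_lt_dimH ?_
    rw [← hd, ENNReal.coe_lt_coe, Real.toNNReal_lt_iff_lt_coe (by linarith)]
    exact sub_lt_self _ hη0
  filter_upwards [ae_hausdorffMeasure_eq_zero h (σ := d + η) (τ := τ) (t := t) (β := d - 2 * η)
    (s := d - η) (by linarith) hτm.le (by linarith) (by linarith) (by linarith) (by linarith) hσ]
    with V hV hlt
  simp only [packingDim, iInf_lt_iff] at hlt
  obtain ⟨F, hFb, hFK, hF⟩ := hlt
  have hnull : ∀ i, Measure.hausdorffMeasure ((d : ℝ) - η) (K ∩ V.proj ⁻¹' F i) = 0 := by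
    intro i
    obtain ⟨k₀, hk₀⟩ := exists_forall_coverNum_le (F := F i) (t := t) (by
      rw [ENNReal.ofReal_coe_nnreal]
      exact (le_iSup (fun i => upperBoxDim (F i)) i).trans_lt hF)
    refine hV _ inter_subset_left k₀ fun k hk => ?_
    obtain ⟨C, hC, hcov⟩ := exists_cover_card_eq_coverNum (hFb i)
      (by positivity : (0 : ℝ) < (1 / 2) ^ k)
    refine ⟨C, by rw [hC]; exact hk₀ k hk, Subset.trans ?_ hcov⟩
    exact image_subset_iff.2 inter_subset_right
  have hKsub : K ⊆ ⋃ i, K ∩ V.proj ⁻¹' F i := by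
    intro x hx
    obtain ⟨i, hi⟩ := mem_iUnion.1 (hFK (mem_image_of_mem _ hx))
    exact mem_iUnion.2 ⟨i, hx, hi⟩
  have h0 := measure_mono_null hKsub (measure_iUnion_null hnull)
  rw [hs] at h0
  exact ENNReal.top_ne_zero h0

end ProjDim

theorem theorem1p3 (n m : ℕ) (hm : 0 < m) (hmn : m < n)
    (K : Set (EuclideanSpace ℝ (Fin n))) :
    ∀ᵐ V ∂(ProjDim.grassMeasure hmn.le),
      min (dimH K) (m : ENNReal) ≤ ProjDim.packingDim (V.proj '' K) := by
  have h : ∀ᵐ V ∂(ProjDim.grassMeasure hmn.le), ∀ q : ℚ,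
      (((q : ℝ).toNNReal : NNReal) : ENNReal) < min (dimH K) m →
        ¬ ProjDim.packingDim (V.proj '' K) < ((q : ℝ).toNNReal : NNReal) := by
    refine ae_all_iff.2 fun q => ?_
    by_cases hq : (((q : ℝ).toNNReal : NNReal) : ENNReal) < min (dimH K) m
    · filter_upwards [ProjDim.ae_not_packingDim_lt hmn.le K _ hq] with V hV _ using hV
    · exact Eventually.of_forall fun V h => absurd h hq
  filter_upwards [h] with V hV
  by_contra! hlt
  obtain ⟨q, -, h1, h2⟩ := ENNReal.lt_iff_exists_rat_btwn.1 hlt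
  exact hV q h2 h1
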